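/- Let $\mathcal A$ be a small category and let $M:\mathcal A^{op}\times\mathcal A\to\mathsf{Set}$ be a flat module, i.e. for every object $a$ the functor $M(a,-):\mathcal A\to\mathsf{Set}$ is flat (its category of elements is cofiltered). For $f:a'\to a$, $g:b\to b'$ and $m\in M(a,b)$ write $m@f=M(f,b)(m)$ and $g@m=M(a,g)(m)$. Let $\mathsf{Flat}(\mathcal A)$ be the category of flat functors $\mathcal A\to\mathsf{Set}$ and natural transformations, and let $M\otimes-:\mathsf{Flat}(\mathcal A)\to\mathsf{Flat}(\mathcal A)$ be the functor $(M\otimes X)(a)=\int^{b}M(b,a)\times X(b)$. An $M$-complex is a sequence of objects $a_0,a_1,a_2,\dots$ of $\mathcal A$ together with elements $m_{n+1}\in M(a_{n+1},a_n)$ for $n\ge 0$. A morphism from $(a_\bullet,m_\bullet)$ to $(a'_\bullet,m'_\bullet)$ is a sequence of morphisms $f_n:a_n\to a'_n$ with $m'_{n+1}@f_{n+1}=f_n@m_{n+1}$ for all $n\ge 0$. Let $\mathsf{Complex}(M)$ be the resulting category, let $\mathsf{Complex}_n(M)$ be the category of $n$-truncated complexes $(a_n,\dots,a_0;m_n,\dots,m_1)$,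 defined in the same way, and let $\mathrm{pr}_n:\mathsf{Complex}(M)\to\mathsf{Complex}_n(M)$ be the truncation functor; $\mathsf{Complex}_0(M)=\mathcal A$. Assume that 1. $\mathsf{Complex}(M)$ is nonempty, i.e. at least one $M$-complex exists; 2. $M$ is compact: for every $n\ge 0$ and every diagram $D:\mathcal D\to\mathsf{Complex}(M)$ with $\mathcal D$ a finite nonempty category, there is a nonempty finite set $S$ of cones for $\mathrm{pr}_n\cdot D$ such that every cone for $\mathrm{pr}_n\cdot D$ factors through some cone in $S$; 3. $M$ satisfies the Weak Solvability Condition: for every diagram $D:\mathcal D\to\mathsf{Complex}(M)$ with $\mathcal D$ a finite (possibly empty) category, there is a cone for $\mathrm{pr}_0\cdot D$ in $\mathcal A$. Then the functor $M\otimes-:\mathsf{Flat}(\mathcal A)\to\mathsf{Flat}(\mathcal A)$ has a final coalgebra, i.e. the category of coalgebras $X\to M\otimes X$ with $X$ flat has a terminal object. -/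

import Mathlib

open CategoryTheory CategoryTheory.Limits Opposite

universe u

/-! ### Modules and flatness -/

/-- A module from a small category `A` to a small category `B`: a functor `Aᵒᵖ × B → Set`,
in curried form. The set `M(a, b)` is `(M.obj (op a)).obj b`. -/
abbrev SetModule (A B : Type u) [SmallCategory A] [SmallCategory B] : Type (u + 1) :=
  Aᵒᵖ ⥤ B ⥤ Type u

/-- A functor `X : A ⥤ Type u` is flat if its category of elements is cofiltered. -/
def IsFlatFunctor (A : Type u) [SmallCategory A] : ObjectProperty (A ⥤ Type u) :=
  fun X => IsCofiltered X.Elements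

/-- The category of flat functors and all natural transformations between them. -/
abbrev FlatCat (A : Type u) [SmallCategory A] : Type (u + 1) :=
  (IsFlatFunctor A).FullSubcategory

namespace SetModule

variable {A B : Type u} [SmallCategory A] [SmallCategory B]

/-- The set `M(a, b)`, whose elements are the broken arrows from `a` to `b`. -/
abbrev El (M : SetModule A B) (a : A) (b : B) : Type u := (M.obj (op a)).obj b

/-- The action `m @ f` of a morphism `f : a' ⟶ a` on `m ∈ M(a, b)`. -/
abbrev actSource (M : SetModule A B) {a a' : A} {b : B} (m : M.El a b) (f : a' ⟶ a) :
    M.El a' b :=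
  (M.map f.op).app b m

/-- The action `g @ m` of a morphism `g : b ⟶ b'` on `m ∈ M(a, b)`. -/
abbrev actTarget (M : SetModule A B) {a : A} {b b' : B} (g : b ⟶ b') (m : M.El a b) :
    M.El a b' :=
  (M.obj (op a)).map g m

/-- A module is flat if every partial functor `M(a, -)` is flat. -/
def IsFlat (M : SetModule A B) : Prop :=
  ∀ a : A, IsFlatFunctor B (M.obj (op a))

/-! ### The functor `M ⊗ -` -/

/-- The bifunctor `(b', b) ↦ M(b', a) × X b`, whose coend is `(M ⊗ X) a`. -/
def integrand (M : SetModule A B) (X : A ⥤ Type u) (a : B) : Aᵒᵖ ⥤ A ⥤ Type u where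
  obj b' :=
    { obj b := (M.obj b').obj a × X.obj b
      map f := ↾fun p => (p.1, X.map f p.2) }
  map g := { app b := ↾fun p => ((M.map g).app a p.1, p.2) }

/-- The coend `(M ⊗ X) a = ∫^b M(b, a) × X b`, as a set of equivalence classes. -/
abbrev tensorObj (M : SetModule A B) (X : A ⥤ Type u) (a : B) : Type u :=
  Types.coend (M.integrand X a)

/-- The element `m ⊗ x` of `(M ⊗ X) a`. -/
def tmul (M : SetModule A B) {X : A ⥤ Type u} {a : B} {b : A} (m : M.El b a) (x : X.obj b) :
    M.tensorObj X a :=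
  Quot.mk _ ⟨b, (m, x)⟩

lemma tmul_surjective (M : SetModule A B) {X : A ⥤ Type u} {a : B} (t : M.tensorObj X a) :
    ∃ (b : A) (m : M.El b a) (x : X.obj b), M.tmul m x = t := by
  obtain ⟨⟨b, m, x⟩, rfl⟩ := Quot.exists_rep t
  exact ⟨b, m, x, rfl⟩

/-- The defining relation `(m @ f) ⊗ x = m ⊗ (f @ x)`. -/
lemma tmul_balanced (M : SetModule A B) {X : A ⥤ Type u} {a : B} {b b' : A} (f : b ⟶ b')
    (m : M.El b' a) (x : X.obj b) :
    M.tmul (M.actSource m f) x = M.tmul m (X.map f x) :=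
  Quot.sound (Types.coendRel.mk (F := M.integrand X a) f (m, x))

/-- A function out of `(M ⊗ X) a` from a balanced function of pairs. -/
def tensorLift (M : SetModule A B) {X : A ⥤ Type u} {a : B} {T : Type u}
    (φ : ∀ b : A, M.El b a → X.obj b → T)
    (h : ∀ (b b' : A) (f : b ⟶ b') (m : M.El b' a) (x : X.obj b),
      φ b (M.actSource m f) x = φ b' m (X.map f x)) :
    M.tensorObj X a → T :=
  Quot.lift (fun p => φ p.1 p.2.1 p.2.2) (by
    rintro _ _ ⟨f, y⟩
    exact h _ _ f y.1 y.2)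

/-- The functor `M ⊗ X : B → Set`, with `g` acting by `m ⊗ x ↦ (g @ m) ⊗ x`. -/
def tensor (M : SetModule A B) (X : A ⥤ Type u) : B ⥤ Type u where
  obj a := M.tensorObj X a
  map {a a'} g := ↾(M.tensorLift (fun _ m x => M.tmul (M.actTarget g m) x) (by
    intro b b' f m x
    rw [← M.tmul_balanced]
    congr 1
    exact ((M.map f.op).naturality_apply g m).symm))
  map_id a := by
    ext t
    obtain ⟨b, m, x, rfl⟩ := M.tmul_surjective t
    change M.tmul (M.actTarget (𝟙 a) m) x = M.tmul m x
    simp [actTarget]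
  map_comp {a a' a''} g g' := by
    ext t
    obtain ⟨b, m, x, rfl⟩ := M.tmul_surjective t
    change M.tmul (M.actTarget (g ≫ g') m) x = M.tmul (M.actTarget g' (M.actTarget g m)) x
    simp [actTarget]

@[simp]
lemma tensor_map_tmul (M : SetModule A B) (X : A ⥤ Type u) {a a' : B} (g : a ⟶ a') {b : A}
    (m : M.El b a) (x : X.obj b) :
    (M.tensor X).map g (M.tmul m x) = M.tmul (M.actTarget g m) x := rfl

/-- The natural transformation `M ⊗ α : M ⊗ X ⟶ M ⊗ Y`, given by `m ⊗ x ↦ m ⊗ α x`. -/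
def tensorMap (M : SetModule A B) {X Y : A ⥤ Type u} (α : X ⟶ Y) : M.tensor X ⟶ M.tensor Y where
  app a := ↾(M.tensorLift (fun b m x => M.tmul m (α.app b x)) (by
    intro b b' f m x
    rw [M.tmul_balanced]
    congr 1
    exact (α.naturality_apply f x).symm))
  naturality {a a'} g := by
    ext t
    obtain ⟨b, m, x, rfl⟩ := M.tmul_surjective t
    rfl

@[simp]
lemma tensorMap_app_tmul (M : SetModule A B) {X Y : A ⥤ Type u} (α : X ⟶ Y) {a : B} {b : A}
    (m : M.El b a) (x : X.obj b) :
    (M.tensorMap α).app a (M.tmul m x) = M.tmul m (α.app b x) := rfl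

/-- When `X` is flat, two elements `m ⊗ x` and `m' ⊗ x'` are equal if and only if they have a
common refinement. -/
lemma tmul_eq_iff (M : SetModule A B) {X : A ⥤ Type u} (hX : IsFlatFunctor A X) {a : B}
    {b b' : A} (m : M.El b a) (x : X.obj b) (m' : M.El b' a) (x' : X.obj b') :
    M.tmul m x = M.tmul m' x' ↔
      ∃ (c : A) (z : X.obj c) (f : c ⟶ b) (f' : c ⟶ b'),
        X.map f z = x ∧ X.map f' z = x' ∧ M.actSource m f = M.actSource m' f' := by
  have : IsCofiltered X.Elements := hX
  constructor
  · let R : (Σ b : A, M.El b a × X.obj b) → (Σ b : A, M.El b a × X.obj b) → Prop :=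
      fun p q => ∃ (c : A) (z : X.obj c) (f : c ⟶ p.1) (f' : c ⟶ q.1),
        X.map f z = p.2.2 ∧ X.map f' z = q.2.2 ∧
          M.actSource p.2.1 f = M.actSource q.2.1 f'
    have hR : Equivalence R := by
      refine ⟨fun p => ⟨p.1, p.2.2, 𝟙 _, 𝟙 _, by simp, by simp, rfl⟩, ?_, ?_⟩
      · rintro p q ⟨c, z, f, f', h1, h2, h3⟩
        exact ⟨c, z, f', f, h2, h1, h3.symm⟩
      · rintro ⟨p, n, y⟩ ⟨q, n', y'⟩ ⟨r, n'', y''⟩ ⟨c, z, f, f', h1, h2, h3⟩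
          ⟨d, w, g, g', k1, k2, k3⟩
        dsimp only at *
        let φ : X.elementsMk c z ⟶ X.elementsMk q y' := ⟨f', h2⟩
        let ψ : X.elementsMk d w ⟶ X.elementsMk q y' := ⟨g, k1⟩
        obtain ⟨e, s, t, hst⟩ := IsCofiltered.cospan φ ψ
        have hst' : s.1 ≫ f' = t.1 ≫ g := congrArg Subtype.val hst
        have hs : X.map s.1 e.2 = z := s.2
        have ht : X.map t.1 e.2 = w := t.2
        refine ⟨e.1, e.2, s.1 ≫ f, t.1 ≫ g', ?_, ?_, ?_⟩
        · simp [hs, h1]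
        · simp [ht, k2]
        · have e1 : M.actSource n (s.1 ≫ f) = M.actSource (M.actSource n f) s.1 := by
            simp [actSource]
          have e2 : M.actSource (M.actSource n' f') s.1 = M.actSource n' (s.1 ≫ f') := by
            simp [actSource]
          have e3 : M.actSource n' (t.1 ≫ g) = M.actSource (M.actSource n' g) t.1 := by
            simp [actSource]
          have e4 : M.actSource (M.actSource n'' g') t.1 = M.actSource n'' (t.1 ≫ g') := by
            simp [actSource]
          rw [e1, h3, e2, hst', e3, k3, e4]
    intro h
    have h' := Quot.eqvGen_exact h
    have key : ∀ p q : (Σ b : A, M.El b a × X.obj b),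
        Relation.EqvGen (Types.coendRel (M.integrand X a)) p q → R p q := by
      intro p q hpq
      induction hpq with
      | rel p q h =>
        obtain ⟨f, y⟩ := h
        rename_i j j'
        have e1 : X.map (𝟙 j) y.2 = y.2 := by simp
        have e2 : M.actSource (M.actSource y.1 f) (𝟙 j) = M.actSource y.1 f := by
          simp [actSource]
        exact ⟨j, y.2, 𝟙 j, f, e1, rfl, e2⟩
      | refl p => exact hR.refl p
      | symm p q _ ih => exact hR.symm ih
      | trans p q r _ _ ih ih' => exact hR.trans ih ih'
    exact key _ _ h'
  · rintro ⟨c, z, f, f', rfl, rfl, h⟩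
    rw [← M.tmul_balanced, ← M.tmul_balanced, h]

/-- If `M` is a flat module and `X` is a flat functor, then `M ⊗ X` is a flat functor. -/
lemma isFlatFunctor_tensor (M : SetModule A B) (hM : M.IsFlat) {X : A ⥤ Type u}
    (hX : IsFlatFunctor A X) : IsFlatFunctor B (M.tensor X) := by
  have : IsCofiltered X.Elements := hX
  have : ∀ c, IsCofiltered (M.obj (op c)).Elements := hM
  refine @IsCofiltered.mk _ _ ⟨?_, ?_⟩ ?_
  · rintro ⟨a, t⟩ ⟨a', t'⟩
    obtain ⟨b, m, x, rfl⟩ := M.tmul_surjective t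
    obtain ⟨b', m', x', rfl⟩ := M.tmul_surjective t'
    obtain ⟨⟨c, z⟩, f, f', -⟩ := IsCofilteredOrEmpty.cone_objs (X.elementsMk b x)
      (X.elementsMk b' x')
    obtain ⟨⟨d, n⟩, g, g', -⟩ := IsCofilteredOrEmpty.cone_objs
      ((M.obj (op c)).elementsMk a (M.actSource m f.1))
      ((M.obj (op c)).elementsMk a' (M.actSource m' f'.1))
    refine ⟨⟨d, M.tmul n z⟩, ⟨g.1, ?_⟩, ⟨g'.1, ?_⟩, trivial⟩
    · have h1 : M.actTarget g.1 n = M.actSource m f.1 := g.2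
      have h2 : X.map f.1 z = x := f.2
      change M.tmul (M.actTarget g.1 n) z = M.tmul m x
      rw [h1, M.tmul_balanced, h2]
    · have h1 : M.actTarget g'.1 n = M.actSource m' f'.1 := g'.2
      have h2 : X.map f'.1 z = x' := f'.2
      change M.tmul (M.actTarget g'.1 n) z = M.tmul m' x'
      rw [h1, M.tmul_balanced, h2]
  · rintro ⟨a, t⟩ ⟨a', t'⟩ ⟨f, hf⟩ ⟨g, hg⟩
    obtain ⟨b, m, x, rfl⟩ := M.tmul_surjective t
    have hfg : M.tmul (M.actTarget f m) x = M.tmul (M.actTarget g m) x := hf.trans hg.symm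
    obtain ⟨c, z, p, p', h1, h2, h3⟩ := (M.tmul_eq_iff hX _ _ _ _).1 hfg
    let φ : X.elementsMk c z ⟶ X.elementsMk b x := ⟨p, h1⟩
    let ψ : X.elementsMk c z ⟶ X.elementsMk b x := ⟨p', h2⟩
    obtain ⟨⟨d, w⟩, q, hq⟩ := IsCofilteredOrEmpty.cone_maps φ ψ
    have hq' : q.1 ≫ p = q.1 ≫ p' := congrArg Subtype.val hq
    have hw : X.map q.1 w = z := q.2
    have hnat : ∀ (k : a ⟶ a') (r : c ⟶ b), M.actTarget k (M.actSource m (q.1 ≫ r)) =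
        M.actSource (M.actSource (M.actTarget k m) r) q.1 := by
      intro k r
      have e1 : M.actSource (M.actSource (M.actTarget k m) r) q.1 =
        M.actSource (M.actTarget k m) (q.1 ≫ r) := by simp [actSource]
      rw [e1]
      exact ((M.map (q.1 ≫ r).op).naturality_apply k m).symm
    have heq : M.actTarget f (M.actSource m (q.1 ≫ p)) =
        M.actTarget g (M.actSource m (q.1 ≫ p)) := by
      rw [hnat, h3, ← hnat, ← hq']
    let φ' : (M.obj (op d)).elementsMk a (M.actSource m (q.1 ≫ p)) ⟶
      (M.obj (op d)).elementsMk a' (M.actTarget f (M.actSource m (q.1 ≫ p))) := ⟨f, rfl⟩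
    let ψ' : (M.obj (op d)).elementsMk a (M.actSource m (q.1 ≫ p)) ⟶
      (M.obj (op d)).elementsMk a' (M.actTarget f (M.actSource m (q.1 ≫ p))) := ⟨g, heq.symm⟩
    obtain ⟨⟨e, k⟩, h, hh⟩ := IsCofilteredOrEmpty.cone_maps φ' ψ'
    refine ⟨⟨e, M.tmul k w⟩, ⟨h.1, ?_⟩, ?_⟩
    · have hk : M.actTarget h.1 k = M.actSource m (q.1 ≫ p) := h.2
      change M.tmul (M.actTarget h.1 k) w = M.tmul m x
      have e1 : X.map (q.1 ≫ p) w = x := by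
        rw [← h1]
        exact (X.map_comp_apply q.1 p w).trans (congrArg (X.map p) hw)
      rw [hk, M.tmul_balanced, e1]
    · exact Subtype.ext (congrArg Subtype.val hh :)
  · obtain ⟨b, x⟩ := (IsCofiltered.nonempty : Nonempty X.Elements)
    obtain ⟨a, m⟩ := (IsCofiltered.nonempty : Nonempty (M.obj (op b)).Elements)
    exact ⟨⟨a, M.tmul m x⟩⟩

/-- The functor `M ⊗ -` from flat functors on `A` to flat functors on `B`, for a flat module `M`
from `A` to `B`. For `A = B` it is an endofunctor. -/
def tensorFunctor (M : SetModule A B) (hM : M.IsFlat) : FlatCat A ⥤ FlatCat B where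
  obj X := ⟨M.tensor X.obj, M.isFlatFunctor_tensor hM X.property⟩
  map α := ObjectProperty.homMk (M.tensorMap α.hom)
  map_id X := by
    ext a t
    obtain ⟨b, m, x, rfl⟩ := M.tmul_surjective t
    rfl
  map_comp α β := by
    ext a t
    obtain ⟨b, m, x, rfl⟩ := M.tmul_surjective t
    rfl

end SetModule

/-! ### Complexes -/

/-- An `M`-complex: a chain `⋯ a₂ ⇸ a₁ ⇸ a₀` of broken arrows `elt n ∈ M(a (n + 1), a n)`. -/
structure MComplex {A : Type u} [SmallCategory A] (M : SetModule A A) : Type u where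
  obj : ℕ → A
  elt : ∀ n : ℕ, M.El (obj (n + 1)) (obj n)

namespace MComplex

variable {A : Type u} [SmallCategory A] {M : SetModule A A}

/-- A morphism of complexes: a sequence of morphisms making all squares commute. -/
@[ext]
structure Hom (X Y : MComplex M) : Type u where
  app : ∀ n : ℕ, X.obj n ⟶ Y.obj n
  comm : ∀ n : ℕ, M.actSource (Y.elt n) (app (n + 1)) = M.actTarget (app n) (X.elt n)

instance : Category.{u} (MComplex M) where
  Hom := Hom
  id X := { app n := 𝟙 _, comm n := by simp [SetModule.actSource, SetModule.actTarget] }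
  comp {X Y Z} f g :=
    { app n := f.app n ≫ g.app n
      comm n := by
        have h1 := f.comm n
        have h2 := g.comm n
        have h3 := (M.map (f.app (n + 1)).op).naturality_apply (g.app n) (Y.elt n)
        simp only [SetModule.actSource, SetModule.actTarget] at h1 h2 ⊢
        simp [h2, h3, h1] }

end MComplex

/-- An `n`-truncated `M`-complex: a chain `aₙ ⇸ ⋯ ⇸ a₁ ⇸ a₀` of `n` broken arrows. -/
structure TruncComplex {A : Type u} [SmallCategory A] (M : SetModule A A) (n : ℕ) : Type u where
  obj : Fin (n + 1) → A
  elt : ∀ i : Fin n, M.El (obj i.succ) (obj i.castSucc)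

namespace TruncComplex

variable {A : Type u} [SmallCategory A] {M : SetModule A A} {n : ℕ}

/-- A morphism of truncated complexes. -/
@[ext]
structure Hom (X Y : TruncComplex M n) : Type u where
  app : ∀ i : Fin (n + 1), X.obj i ⟶ Y.obj i
  comm : ∀ i : Fin n,
    M.actSource (Y.elt i) (app i.succ) = M.actTarget (app i.castSucc) (X.elt i)

instance : Category.{u} (TruncComplex M n) where
  Hom := Hom
  id X := { app i := 𝟙 _, comm i := by simp [SetModule.actSource, SetModule.actTarget] }
  comp {X Y Z} f g :=
    { app i := f.app i ≫ g.app i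
      comm i := by
        have h1 := f.comm i
        have h2 := g.comm i
        have h3 := (M.map (f.app i.succ).op).naturality_apply (g.app i.castSucc) (Y.elt i)
        simp only [SetModule.actSource, SetModule.actTarget] at h1 h2 ⊢
        simp [h2, h3, h1] }

end TruncComplex

namespace MComplex

variable {A : Type u} [SmallCategory A]

/-- The truncation functor from complexes to `n`-truncated complexes. -/
def pr (M : SetModule A A) (n : ℕ) : MComplex M ⥤ TruncComplex M n where
  obj X := { obj i := X.obj i, elt i := X.elt i }
  map f := { app i := f.app i, comm i := f.comm i }

end MComplex

/-! ### Solvability and compactness -/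

/-- A functor `F : X ⥤ Y` is cofiltering if for every diagram `D` in `X` of finite shape, the
composite diagram `D ⋙ F` has a cone in `Y`. The empty shape is included. -/
def IsCofilteringFunctor {X Y : Type*} [Category* X] [Category* Y] (F : X ⥤ Y) : Prop :=
  ∀ (J : Type) [SmallCategory J] [FinCategory J] (D : J ⥤ X), Nonempty (Cone (D ⋙ F))

namespace SetModule

variable {A : Type u} [SmallCategory A]

/-- The Weak Solvability Condition: the head functor from complexes to `0`-truncated complexes
(that is, to `A`) is cofiltering. -/
def WeakSolvability (M : SetModule A A) : Prop :=
  IsCofilteringFunctor (MComplex.pr M 0)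

/-- A module is compact if, for every `n` and every diagram `D` of complexes of nonempty finite
shape, the preorder of cones for `D ⋙ pr M n` (where `c ⊑ c'` means that `c` factors through
`c'`) has a nonempty finite final subset. -/
def IsCompactModule (M : SetModule A A) : Prop :=
  ∀ (n : ℕ) (J : Type) [SmallCategory J] [FinCategory J] [Nonempty J] (D : J ⥤ MComplex M),
    ∃ S : Set (Cone (D ⋙ MComplex.pr M n)), S.Finite ∧ S.Nonempty ∧
      ∀ c : Cone (D ⋙ MComplex.pr M n), ∃ s ∈ S, Nonempty (c ⟶ s)

end SetModule

/-! The final coalgebra is the colimit of the representables `A(c₀, -)` over complexes `c`: its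
elements at `a` are pairs of a complex `c` and a map `c₀ ⟶ a`, identified when they have a common
refinement. Its structure map splits off the first broken arrow.

This colimit is flat as soon as the category of complexes is cofiltered. Compactness gives that by a
König argument (`MComplex.nonempty_cone`): coherent choices from the finite sets of truncated cones
exist, and the diagonal of such a choice is a cone of complexes.

For a flat coalgebra `X`, unfolding the structure map forever resolves each element by a complex.
Resolutions are not unique, but flatness of `X` lets a common refinement of two elements be
continued one stage at a time (`Refinement.exists_next`), so the class of the resolving complex
depends only on the element. This defines the map to the colimit. It is unique because coalgebra
maps preserve resolutions, and an element of the colimit resolved by `c` is the class of `c` itself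
(`classOf_classStr`). -/

namespace SetModule

variable {A B : Type u} [SmallCategory A] [SmallCategory B] (M : SetModule A B)

lemma actTarget_id {a : A} {b : B} (m : M.El a b) : M.actTarget (𝟙 b) m = m := by
  simp [actTarget]

lemma actSource_comp {a a' a'' : A} {b : B} (m : M.El a b) (f : a' ⟶ a) (g : a'' ⟶ a') :
    M.actSource m (g ≫ f) = M.actSource (M.actSource m f) g := by
  simp [actSource]

lemma actTarget_comp {a : A} {b b' b'' : B} (m : M.El a b) (f : b ⟶ b') (g : b' ⟶ b'') :
    M.actTarget (f ≫ g) m = M.actTarget g (M.actTarget f m) := by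
  simp [actTarget]

lemma actSource_actTarget {a a' : A} {b b' : B} (m : M.El a b) (f : a' ⟶ a) (g : b ⟶ b') :
    M.actSource (M.actTarget g m) f = M.actTarget g (M.actSource m f) :=
  (M.map f.op).naturality_apply g m

end SetModule

variable {A : Type u} [SmallCategory A] {M : SetModule A A}

/-! ### Compactness and cofilteredness of the category of complexes -/

namespace TruncComplex

/-- Forgetting the last broken arrow of a truncated complex. -/
def trunc (M : SetModule A A) (n : ℕ) : TruncComplex M (n + 1) ⥤ TruncComplex M n where
  obj X := { obj i := X.obj i.castSucc, elt i := X.elt i.castSucc }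
  map f := { app i := f.app i.castSucc, comm i := f.comm i.castSucc }

/-- Truncating a cone of truncated complexes. -/
def truncCone {J : Type} [SmallCategory J] {D : J ⥤ MComplex M} {n : ℕ}
    (c : Cone (D ⋙ MComplex.pr M (n + 1))) : Cone (D ⋙ MComplex.pr M n) :=
  (trunc M n).mapCone c

end TruncComplex

namespace MComplex

@[simp]
lemma id_app (X : MComplex M) (n : ℕ) : Hom.app (𝟙 X) n = 𝟙 (X.obj n) := rfl

@[simp]
lemma comp_app {X Y Z : MComplex M} (f : X ⟶ Y) (g : Y ⟶ Z) (n : ℕ) :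
    Hom.app (f ≫ g) n = Hom.app f n ≫ Hom.app g n := rfl

section Diagonal

variable {J : Type} [SmallCategory J] {D : J ⥤ MComplex M}
  (s : ∀ n, Cone (D ⋙ pr M n)) (t : ∀ n, TruncComplex.truncCone (s (n + 1)) ⟶ s n)

/-- The diagonal of a tower of cones of truncated complexes. -/
def diagonal : MComplex M where
  obj n := (s n).pt.obj (Fin.last n)
  elt n := M.actTarget (TruncComplex.Hom.app (t n).hom (Fin.last n))
    ((s (n + 1)).pt.elt (Fin.last n))

/-- The projection from the diagonal to a vertex of the diagram. -/
def diagonalπ (j : J) : diagonal s t ⟶ D.obj j where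
  app n := TruncComplex.Hom.app ((s n).π.app j) (Fin.last n)
  comm n := by
    have h1 := TruncComplex.Hom.comm ((s (n + 1)).π.app j) (Fin.last n)
    have h2 := congrArg (fun f => TruncComplex.Hom.app f (Fin.last n)) ((t n).w j)
    change TruncComplex.Hom.app (t n).hom (Fin.last n) ≫
      TruncComplex.Hom.app ((s n).π.app j) (Fin.last n) =
      TruncComplex.Hom.app ((s (n + 1)).π.app j) (Fin.last n).castSucc at h2
    rw [← h2] at h1
    exact h1.trans (M.actTarget_comp _ _ _)

/-- The diagonal of a tower of cones of truncated complexes, as a cone of complexes. -/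
def diagonalCone : Cone D where
  pt := diagonal s t
  π :=
    { app := diagonalπ s t
      naturality i j f := by
        refine (Category.id_comp _).trans (MComplex.Hom.ext (funext fun n => ?_))
        exact (congrArg (fun g => TruncComplex.Hom.app g (Fin.last n)) ((s n).w f)).symm }

end Diagonal

/-- König's lemma: the finite nonempty sets `S n` form an inverse system, which has a section. The
comparison maps along the section need not be invertible, so the limit complex takes the last vertex
of each cone. -/
theorem nonempty_cone (h : M.IsCompactModule) (J : Type) [SmallCategory J] [FinCategory J]
    [Nonempty J] (D : J ⥤ MComplex M) : Nonempty (Cone D) := by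
  choose S hfin hne hS using fun n => h n J D
  -- `r n c` is a member of `S n` through which the truncation of `c` factors.
  choose r hr ht using fun n (c : S (n + 1)) => hS n (TruncComplex.truncCone c.1)
  let F : ℕᵒᵖ ⥤ Type u :=
    Functor.ofOpSequence (X := fun n => (S n : Type u)) fun n => ↾fun c => ⟨r n c, hr n c⟩
  have : ∀ j, Finite (F.obj j) := fun j => hfin j.unop
  have : ∀ j, Nonempty (F.obj j) := fun j => (hne j.unop).to_subtype
  obtain ⟨s, hs⟩ := nonempty_sections_of_finite_cofiltered_system F
  let s' : ∀ n, S n := fun n => s (op n)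
  have hs' : ∀ n, r n (s' (n + 1)) = (s' n).1 := fun n => by
    have := hs (homOfLE (Nat.le_add_right n 1)).op
    rw [Functor.ofOpSequence_map_homOfLE_succ] at this
    exact congrArg Subtype.val this
  exact ⟨diagonalCone (fun n => (s' n).1) fun n => (ht n (s' (n + 1))).some ≫ eqToHom (hs' n)⟩

theorem isCofiltered (h : M.IsCompactModule) (hne : Nonempty (MComplex M)) :
    IsCofiltered (MComplex M) where
  nonempty := hne
  cone_objs X Y := by
    obtain ⟨c⟩ := nonempty_cone h _ (pair X Y)
    exact ⟨c.pt, c.π.app ⟨.left⟩, c.π.app ⟨.right⟩, trivial⟩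
  cone_maps X Y f g := by
    obtain ⟨c⟩ := nonempty_cone h _ (parallelPair f g)
    exact ⟨c.pt, c.π.app .zero, (c.w WalkingParallelPairHom.left).trans
      (c.w WalkingParallelPairHom.right).symm⟩

/-! ### Shifts of complexes -/

/-- The complex obtained by dropping the head. -/
def shift (X : MComplex M) : MComplex M where
  obj n := X.obj (n + 1)
  elt n := X.elt (n + 1)

/-- The shift of a morphism of complexes. -/
def shiftMap {X Y : MComplex M} (f : X ⟶ Y) : X.shift ⟶ Y.shift where
  app n := f.app (n + 1)
  comm n := f.comm (n + 1)

/-- The complex obtained by dropping the first `n` broken arrows. -/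
def drop (X : MComplex M) (n : ℕ) : MComplex M where
  obj k := X.obj (n + k)
  elt k := X.elt (n + k)

lemma actSource_elt_eqToHom (X : MComplex M) {i j : ℕ} (h : i = j) :
    M.actSource (X.elt j) (eqToHom (by rw [h])) =
      M.actTarget (eqToHom (by rw [h])) (X.elt i) := by
  subst h
  simp [SetModule.actSource, SetModule.actTarget]

/-- The comparison of the two ways of dropping `n + 1` broken arrows. -/
def dropSucc (X : MComplex M) (n : ℕ) : (X.drop n).shift ⟶ X.drop (n + 1) where
  app k := eqToHom (congrArg X.obj (by lia))
  comm _ := X.actSource_elt_eqToHom (by lia)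

/-- The comparison of a complex with the one obtained by dropping no broken arrow. -/
def dropZero (X : MComplex M) : X.drop 0 ⟶ X where
  app k := eqToHom (congrArg X.obj (Nat.zero_add k))
  comm k := X.actSource_elt_eqToHom (Nat.zero_add k)

/-! ### The functor of classes of complexes -/

/-- A complex `X` together with a morphism from its head to `a`. -/
structure Over (M : SetModule A A) (a : A) : Type u where
  complex : MComplex M
  hom : complex.obj 0 ⟶ a

/-- Two complexes over `a` are related if some complex maps to both of them over `a`. -/
def Over.Rel {a : A} (p q : Over M a) : Prop :=
  ∃ (c : MComplex M) (g : c ⟶ p.complex) (g' : c ⟶ q.complex),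
    g.app 0 ≫ p.hom = g'.app 0 ≫ q.hom

variable [IsCofiltered (MComplex M)]

lemma Over.rel_equivalence (a : A) : Equivalence (Over.Rel (M := M) (a := a)) where
  refl p := ⟨p.complex, 𝟙 _, 𝟙 _, rfl⟩
  symm := fun ⟨c, g, g', h⟩ => ⟨c, g', g, h.symm⟩
  trans := by
    rintro p q r ⟨c, g, g', h⟩ ⟨d, k, k', h'⟩
    -- The two refinements meet over the middle complex; transitivity is where cofilteredness
    -- enters.
    obtain ⟨e, s, t, hst⟩ := IsCofiltered.cospan g' k
    refine ⟨e, s ≫ g, t ≫ k', ?_⟩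
    replace hst := congrArg (fun f => Hom.app f 0) hst
    simp only [comp_app, Category.assoc] at hst ⊢
    rw [h, ← h', reassoc_of% hst]

/-- Complexes over `a`, up to the existence of a common refinement. -/
def classSetoid (M : SetModule A A) [IsCofiltered (MComplex M)] (a : A) : Setoid (Over M a) :=
  ⟨Over.Rel, Over.rel_equivalence a⟩

/-- The functor sending `a` to the set of classes of complexes over `a`, that is, the colimit of
the representable functors at the heads of complexes. -/
def classFunctor (M : SetModule A A) [IsCofiltered (MComplex M)] : A ⥤ Type u where
  obj a := Quotient (classSetoid M a)
  map f := ↾Quotient.map (fun p => ⟨p.complex, p.hom ≫ f⟩) (by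
    rintro p q ⟨c, g, g', h⟩
    exact ⟨c, g, g', by simp [reassoc_of% h]⟩)
  map_id a := by
    ext t
    induction t using Quotient.inductionOn with | _ p
    exact congrArg (Quotient.mk _) (by simp)
  map_comp f g := by
    ext t
    induction t using Quotient.inductionOn with | _ p
    exact congrArg (Quotient.mk _) (by simp)

/-- The class of a complex over `a`. -/
def cls {a : A} (c : MComplex M) (f : c.obj 0 ⟶ a) : (classFunctor M).obj a :=
  Quotient.mk (classSetoid M a) ⟨c, f⟩

lemma cls_surjective {a : A} (t : (classFunctor M).obj a) :
    ∃ (c : MComplex M) (f : c.obj 0 ⟶ a), cls c f = t := by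
  obtain ⟨⟨c, f⟩, rfl⟩ := Quotient.exists_rep t
  exact ⟨c, f, rfl⟩

lemma classFunctor_map_cls {a b : A} (c : MComplex M) (f : c.obj 0 ⟶ a) (g : a ⟶ b) :
    (classFunctor M).map g (cls c f) = cls c (f ≫ g) := rfl

lemma cls_eq_iff {a : A} {c c' : MComplex M} {f : c.obj 0 ⟶ a} {f' : c'.obj 0 ⟶ a} :
    cls c f = cls c' f' ↔
      ∃ (d : MComplex M) (g : d ⟶ c) (g' : d ⟶ c'), g.app 0 ≫ f = g'.app 0 ≫ f' :=
  Quotient.eq (r := classSetoid M a)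

lemma cls_comp {a : A} {c d : MComplex M} (g : d ⟶ c) (f : c.obj 0 ⟶ a) :
    cls d (g.app 0 ≫ f) = cls c f :=
  cls_eq_iff.2 ⟨d, 𝟙 d, g, by simp⟩

-- Every element is the image of a generic one, `cls d (𝟙 _)`, so cones in the category of elements
-- come from cones of complexes.
variable (M) in
lemma isFlatFunctor_classFunctor : IsFlatFunctor A (classFunctor M) := by
  refine @IsCofiltered.mk _ _ ⟨?_, ?_⟩ ?_
  · rintro ⟨a, t⟩ ⟨a', t'⟩
    obtain ⟨c, f, rfl⟩ := cls_surjective t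
    obtain ⟨c', f', rfl⟩ := cls_surjective t'
    obtain ⟨d, g, g', -⟩ := IsCofilteredOrEmpty.cone_objs c c'
    refine ⟨⟨d.obj 0, cls d (𝟙 _)⟩, ⟨g.app 0 ≫ f, ?_⟩, ⟨g'.app 0 ≫ f', ?_⟩, trivial⟩
    · exact (classFunctor_map_cls _ _ _).trans ((congrArg _ (Category.id_comp _)).trans
        (cls_comp g f))
    · exact (classFunctor_map_cls _ _ _).trans ((congrArg _ (Category.id_comp _)).trans
        (cls_comp g' f'))
  · rintro ⟨a, t⟩ ⟨a', t'⟩ ⟨f, hf⟩ ⟨g, hg⟩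
    obtain ⟨c, k, rfl⟩ := cls_surjective t
    have hfg : cls c (k ≫ f) = cls c (k ≫ g) := hf.trans hg.symm
    obtain ⟨b, h, h', e⟩ := cls_eq_iff.1 hfg
    obtain ⟨d, l, hl⟩ := IsCofilteredOrEmpty.cone_maps h h'
    refine ⟨⟨d.obj 0, cls d (𝟙 _)⟩, ⟨Hom.app (l ≫ h) 0 ≫ k, ?_⟩, Subtype.ext ?_⟩
    · exact (classFunctor_map_cls _ _ _).trans ((congrArg _ (Category.id_comp _)).trans
        (cls_comp (l ≫ h) k))
    · change (Hom.app (l ≫ h) 0 ≫ k) ≫ f = (Hom.app (l ≫ h) 0 ≫ k) ≫ g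
      have hl' := congrArg (fun f => Hom.app f 0) hl
      simp only [comp_app, Category.assoc] at hl' ⊢
      rw [e, reassoc_of% hl']
  · obtain ⟨c⟩ := (IsCofiltered.nonempty : Nonempty (MComplex M))
    exact ⟨⟨c.obj 0, cls c (𝟙 _)⟩⟩

variable (M) in
/-- The coalgebra structure on classes of complexes: it splits off the first broken arrow. -/
def classStr : classFunctor M ⟶ M.tensor (classFunctor M) where
  app a := ↾Quotient.lift (fun p : Over M a =>
      M.tmul (M.actTarget p.hom (p.complex.elt 0)) (cls p.complex.shift (𝟙 _))) (by
    -- Invariance under refinement: the square of `g` at stage 0 turns `g₀ @ d₁` into `c₁ @ g₁`, and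
    -- `g₁` then crosses the tensor sign to act on the class of the shift.
    have key {c d : MComplex M} (g : d ⟶ c) (f : c.obj 0 ⟶ a) :
        M.tmul (M.actTarget (g.app 0 ≫ f) (d.elt 0)) (cls d.shift (𝟙 _)) =
          M.tmul (M.actTarget f (c.elt 0)) (cls c.shift (𝟙 _)) := by
      rw [M.actTarget_comp, ← g.comm 0, ← M.actSource_actTarget, M.tmul_balanced]
      refine congrArg (M.tmul _) (Eq.trans ?_ (cls_comp (shiftMap g) (𝟙 _)))
      exact congrArg (cls _) ((Category.id_comp _).trans (Category.comp_id _).symm)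
    rintro ⟨c, f⟩ ⟨c', f'⟩ ⟨d, g, g', h⟩
    dsimp only at h ⊢
    rw [← key g f, ← key g' f', h])
  naturality a a' f := by
    ext t
    obtain ⟨c, k, rfl⟩ := cls_surjective t
    exact congrArg (M.tmul · _) (M.actTarget_comp _ _ _)

lemma classStr_app_cls {a : A} (c : MComplex M) (f : c.obj 0 ⟶ a) :
    (classStr M).app a (cls c f) = M.tmul (M.actTarget f (c.elt 0)) (cls c.shift (𝟙 _)) := rfl

end MComplex

/-! ### Resolutions of elements of coalgebras -/

/-- A resolution in a coalgebra `e : X ⟶ M ⊗ X`: a complex with elements `x₀, x₁, …` of `X` at its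
vertices, such that `e xₙ = mₙ₊₁ ⊗ xₙ₊₁`. -/
structure Resolution {X : A ⥤ Type u} (e : X ⟶ M.tensor X) : Type u where
  complex : MComplex M
  el : ∀ n, X.obj (complex.obj n)
  str_el : ∀ n, e.app _ (el n) = M.tmul (complex.elt n) (el (n + 1))

namespace Resolution

variable {X : A ⥤ Type u} {e : X ⟶ M.tensor X}

lemma exists_el_zero {a : A} (x : X.obj a) :
    ∃ (R : Resolution e) (f : R.complex.obj 0 ⟶ a), X.map f (R.el 0) = x := by
  choose b m y hy using fun p : X.Elements => M.tmul_surjective (e.app p.1 p.2)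
  -- Iterates a chosen representative `m ⊗ y` of the structure map, starting at `x`.
  let s : ℕ → X.Elements := fun n => Nat.rec ⟨a, x⟩ (fun _ p => ⟨b p, y p⟩) n
  exact ⟨⟨⟨fun n => (s n).1, fun n => m (s n)⟩, fun n => (s n).2, fun n => (hy (s n)).symm⟩,
    𝟙 a, Functor.map_id_apply X (X := a) x⟩

/-- A common refinement of the `n`-th elements of two resolutions. -/
structure Refinement (R R' : Resolution e) (n : ℕ) : Type u where
  obj : A
  el : X.obj obj
  fst : obj ⟶ R.complex.obj n
  snd : obj ⟶ R'.complex.obj n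
  map_fst : X.map fst el = R.el n
  map_snd : X.map snd el = R'.el n

/-- By naturality, both `(f @ q) ⊗ w` and the next stage of `R` represent the image of `R.el n`
under `e`; flatness of `X` gives a common refinement of the two representatives. -/
lemma exists_common {a b : A} (R : Resolution e) (hX : IsFlatFunctor A X) {n : ℕ} {z : X.obj a}
    (f : a ⟶ R.complex.obj n) (hf : X.map f z = R.el n) {q : M.El b a} {w : X.obj b}
    (hq : M.tmul q w = e.app a z) :
    ∃ (v : X.Elements) (r : v ⟶ X.elementsMk b w) (g : v.1 ⟶ R.complex.obj (n + 1)),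
      X.map g v.2 = R.el (n + 1) ∧
        M.actSource (M.actTarget f q) r.1 = M.actSource (R.complex.elt n) g := by
  have h : M.tmul (M.actTarget f q) w = M.tmul (R.complex.elt n) (R.el (n + 1)) := by
    rw [← R.str_el, ← hf, ← M.tensor_map_tmul, hq]
    exact (e.naturality_apply f z).symm
  obtain ⟨c, v, r, g, h1, h2, h3⟩ := (M.tmul_eq_iff hX _ _ _ _).1 h
  exact ⟨⟨c, v⟩, ⟨r, h1⟩, g, h2, h3⟩

lemma Refinement.exists_next (hX : IsFlatFunctor A X) {R R' : Resolution e} {n : ℕ}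
    (s : Refinement R R' n) :
    ∃ (t : Refinement R R' (n + 1)) (q : M.El t.obj s.obj),
      M.actSource (R.complex.elt n) t.fst = M.actTarget s.fst q ∧
        M.actSource (R'.complex.elt n) t.snd = M.actTarget s.snd q := by
  have : IsCofiltered X.Elements := hX
  -- A single representative `q ⊗ w` is compared with both resolutions; since both refinements lie
  -- over `w`, they can be merged, and one broken arrow serves both sides.
  obtain ⟨b, q, w, hq⟩ := M.tmul_surjective (e.app s.obj s.el)
  obtain ⟨v, r, g, h1, h2⟩ := R.exists_common hX s.fst s.map_fst hq
  obtain ⟨v', r', g', h1', h2'⟩ := R'.exists_common hX s.snd s.map_snd hq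
  obtain ⟨c, k, k', hk⟩ := IsCofiltered.cospan r r'
  have hk1 : X.map k.1 c.2 = v.2 := k.2
  have hk2 : X.map k'.1 c.2 = v'.2 := k'.2
  have hk' : k.1 ≫ r.1 = k'.1 ≫ r'.1 := congrArg Subtype.val hk
  refine ⟨⟨c.1, c.2, k.1 ≫ g, k'.1 ≫ g', by simp [hk1, h1], by simp [hk2, h1']⟩,
    M.actSource q (k.1 ≫ r.1), ?_, ?_⟩
  · rw [M.actSource_comp, ← h2, ← M.actSource_comp, M.actSource_actTarget]
  · rw [M.actSource_comp, ← h2', ← M.actSource_comp, M.actSource_actTarget, hk']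

lemma exists_span (hX : IsFlatFunctor A X) {R R' : Resolution e} (s : Refinement R R' 0) :
    ∃ (c : MComplex M) (g : c ⟶ R.complex) (g' : c ⟶ R'.complex) (h : c.obj 0 = s.obj),
      g.app 0 = eqToHom h ≫ s.fst ∧ g'.app 0 = eqToHom h ≫ s.snd := by
  choose t q h h' using fun n (s : Refinement R R' n) => s.exists_next hX
  let σ : ∀ n, Refinement R R' n := fun n => Nat.rec s t n
  exact ⟨⟨fun n => (σ n).obj, fun n => q n (σ n)⟩, ⟨fun n => (σ n).fst, fun n => h n (σ n)⟩,
    ⟨fun n => (σ n).snd, fun n => h' n (σ n)⟩, rfl, by simp [σ], by simp [σ]⟩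

/-- The image of a resolution under a morphism of coalgebras. -/
def map {Y : A ⥤ Type u} {e' : Y ⟶ M.tensor Y} (R : Resolution e) (α : X ⟶ Y)
    (h : e ≫ M.tensorMap α = α ≫ e') : Resolution e' where
  complex := R.complex
  el n := α.app _ (R.el n)
  str_el n := by
    have := ConcreteCategory.congr_hom (NatTrans.congr_app h (R.complex.obj n)) (R.el n)
    refine this.symm.trans ?_
    change (M.tensorMap α).app _ (e.app _ (R.el n)) = _
    rw [R.str_el, M.tensorMap_app_tmul]

/-- The resolution without its head. -/
def shift (R : Resolution e) : Resolution e where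
  complex := R.complex.shift
  el n := R.el (n + 1)
  str_el n := R.str_el (n + 1)

/-! ### The map from a flat coalgebra to classes of complexes -/

variable [IsCofiltered (MComplex M)]

open MComplex

/-- Flatness refines the two heads over `a`; `exists_span` extends this refinement to a complex over
both. -/
lemma cls_eq_cls (hX : IsFlatFunctor A X) {a : A} {R R' : Resolution e}
    {f : R.complex.obj 0 ⟶ a} {f' : R'.complex.obj 0 ⟶ a}
    (h : X.map f (R.el 0) = X.map f' (R'.el 0)) : cls R.complex f = cls R'.complex f' := by
  have : IsCofiltered X.Elements := hX
  let φ : X.elementsMk _ (R.el 0) ⟶ X.elementsMk a (X.map f (R.el 0)) := ⟨f, rfl⟩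
  let φ' : X.elementsMk _ (R'.el 0) ⟶ X.elementsMk a (X.map f (R.el 0)) := ⟨f', h.symm⟩
  obtain ⟨z, k, k', hk⟩ := IsCofiltered.cospan φ φ'
  have hk' : k.1 ≫ f = k'.1 ≫ f' := congrArg Subtype.val hk
  obtain ⟨c, g, g', h0, hg, hg'⟩ :=
    exists_span hX (R := R) (R' := R') ⟨z.1, z.2, k.1, k'.1, k.2, k'.2⟩
  refine cls_eq_iff.2 ⟨c, g, g', ?_⟩
  rw [hg, hg', Category.assoc, Category.assoc]
  exact congrArg _ hk'

variable (e) in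
/-- The function sending an element of a coalgebra to the class of any of its resolutions. -/
noncomputable def classOf {a : A} (x : X.obj a) : (classFunctor M).obj a :=
  cls (exists_el_zero (e := e) x).choose.complex (exists_el_zero (e := e) x).choose_spec.choose

lemma classOf_map_el (hX : IsFlatFunctor A X) (R : Resolution e) {a : A}
    (f : R.complex.obj 0 ⟶ a) : classOf e (X.map f (R.el 0)) = cls R.complex f :=
  cls_eq_cls hX (exists_el_zero (e := e) (X.map f (R.el 0))).choose_spec.choose_spec

lemma classOf_el_zero (hX : IsFlatFunctor A X) (R : Resolution e) :
    classOf e (R.el 0) = cls R.complex (𝟙 _) := by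
  simpa using classOf_map_el hX R (𝟙 _)

variable (e) in
/-- The natural transformation sending an element of a coalgebra to the class of any of its
resolutions. -/
noncomputable def toClassFunctor (hX : IsFlatFunctor A X) : X ⟶ classFunctor M where
  app a := ↾fun x => classOf e x
  naturality a b f := by
    ext x
    obtain ⟨R, g, rfl⟩ := exists_el_zero (e := e) x
    change classOf e (X.map f (X.map g (R.el 0))) =
      (classFunctor M).map f (classOf e (X.map g (R.el 0)))
    rw [classOf_map_el hX, classFunctor_map_cls, ← Functor.map_comp_apply, classOf_map_el hX]

lemma toClassFunctor_str (hX : IsFlatFunctor A X) :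
    e ≫ M.tensorMap (toClassFunctor e hX) = toClassFunctor e hX ≫ classStr M := by
  ext a x
  obtain ⟨R, f, rfl⟩ := exists_el_zero (e := e) x
  change (M.tensorMap (toClassFunctor e hX)).app a (e.app a (X.map f (R.el 0))) =
    (classStr M).app a (classOf e (X.map f (R.el 0)))
  have h : e.app a (X.map f (R.el 0)) = M.tmul (M.actTarget f (R.complex.elt 0)) (R.el 1) := by
    rw [← M.tensor_map_tmul, ← R.str_el]
    exact e.naturality_apply f _
  rw [h, classOf_map_el hX, classStr_app_cls, M.tensorMap_app_tmul]
  exact congrArg _ (classOf_el_zero hX R.shift)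

/-- The canonical resolution, in the coalgebra of classes of complexes, given by a complex. -/
def ofComplex (c : MComplex M) : Resolution (classStr M) where
  complex := c
  el n := cls (c.drop n) (𝟙 (c.obj n))
  str_el n := by
    refine (classStr_app_cls (c.drop n) _).trans ((congrArg (M.tmul · _)
      (M.actTarget_id (c.elt n))).trans ?_)
    refine congrArg (M.tmul _) (Eq.trans ?_ (cls_comp (c.dropSucc n) (𝟙 _)))
    exact congrArg (cls _) (Category.comp_id _).symm

lemma classOf_classStr {a : A} (t : (classFunctor M).obj a) : classOf (classStr M) t = t := by
  obtain ⟨c, f, rfl⟩ := cls_surjective t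
  -- `c.drop 0` has vertices `c.obj (0 + k)`, so it is compared with `c` through `dropZero`.
  have h : (classFunctor M).map f ((ofComplex c).el 0) = cls c f := cls_comp c.dropZero f
  exact (congrArg _ h.symm).trans (classOf_map_el (isFlatFunctor_classFunctor M) (ofComplex c) f)

/-- If `R` resolves `x`, then `R.map α h` resolves `α x` with the same complex, and
`classOf_classStr` recovers `α x` from it. -/
lemma eq_toClassFunctor (hX : IsFlatFunctor A X) (α : X ⟶ classFunctor M)
    (h : e ≫ M.tensorMap α = α ≫ classStr M) : α = toClassFunctor e hX := by
  ext a x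
  obtain ⟨R, f, rfl⟩ := exists_el_zero (e := e) x
  change α.app a (X.map f (R.el 0)) = classOf e (X.map f (R.el 0))
  rw [classOf_map_el hX, ← classOf_classStr (α.app a (X.map f (R.el 0)))]
  have h1 : α.app a (X.map f (R.el 0)) = (classFunctor M).map f ((R.map α h).el 0) :=
    α.naturality_apply f _
  rw [h1]
  exact classOf_map_el (isFlatFunctor_classFunctor M) (R.map α h) f

end Resolution

/-! ### The terminal coalgebra -/

/-- The coalgebra of classes of complexes. -/
def classCoalgebra (M : SetModule A A) (hflat : M.IsFlat) [IsCofiltered (MComplex M)] :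
    Endofunctor.Coalgebra (M.tensorFunctor hflat) where
  V := ⟨MComplex.classFunctor M, MComplex.isFlatFunctor_classFunctor M⟩
  str := ObjectProperty.homMk (MComplex.classStr M)

/-- If the category of complexes is cofiltered, the coalgebra of classes of complexes is
terminal. -/
noncomputable def classCoalgebraIsTerminal (M : SetModule A A) (hflat : M.IsFlat)
    [IsCofiltered (MComplex M)] : IsTerminal (classCoalgebra M hflat) :=
  IsTerminal.ofUniqueHom
    (fun X =>
      { f := ObjectProperty.homMk (Resolution.toClassFunctor X.str.hom X.V.property)
        h := ObjectProperty.hom_ext _ (Resolution.toClassFunctor_str X.V.property) })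
    fun X α => Endofunctor.Coalgebra.ext <| ObjectProperty.hom_ext _ <|
      Resolution.eq_toClassFunctor X.V.property α.f.hom
        (congrArg (fun f => f.hom) α.h)

theorem mainTheorem4 {A : Type u} [SmallCategory A] (M : SetModule A A) (hflat : M.IsFlat)
    (hne : Nonempty (MComplex M)) (hcompact : M.IsCompactModule)
    (hweak : M.WeakSolvability) :
    ∃ T : Endofunctor.Coalgebra (M.tensorFunctor hflat), Nonempty (IsTerminal T) := by
  have := MComplex.isCofiltered hcompact hne
  exact ⟨classCoalgebra M hflat, ⟨classCoalgebraIsTerminal M hflat⟩⟩
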